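/- **Setting.** Let $n\ge 3$ and $\mathcal V=\{1,\dots,n\}$. Let $\mathcal G_t=(\mathcal V,\mathcal E_t)$, $t=0,1,2,\dots$, be an arbitrary deterministic sequence of signed digraphs without self-loops, each arc of $\mathcal E_t$ carrying exactly one sign, so that $\mathcal E_t=\mathcal E_t^+\sqcup\mathcal E_t^-$. For each $t$ let $\mu_t$ be a probability distribution on the subsets of $\mathcal E_t$. Let $(E_t)_{t\ge0}$ be independent random arc sets with $E_t\sim\mu_t$, let $(B_t)_{t\ge0}$ be independent Bernoulli variables with $\mathbb P(B_t=1)=b$, and let $(D_t)_{t\ge0}$ be independent Bernoulli variables with $\mathbb P(D_t=1)=d$; the three processes $(E_t)$, $(B_t)$, $(D_t)$ are independent of one another. Put $N_i^{\pm}(t)=\{j:(j,i)\in E_t\cap\mathcal E_t^{\pm}\}$. In the relative-state-reversion model with weights $\alpha,\beta$, the node states evolve from a deterministic initial state $s(0)\in\mathbb R^n$ by $$s_i(t+1)=s_i(t)-\alpha B_t\sum_{j\in N_i^+(t)}\bigl(s_i(t)-s_j(t)\bigr)+\beta D_t\sum_{j\in N_i^-(t)}\bigl(s_i(t)-s_j(t)\bigr),\qquad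 i\in\mathcal V .$$ **Assumptions.** * (A1) There is $p_*\in(0,1)$ such that $\mathbb P((i,j)\in E_t)\ge p_*$ for all $t\ge0$ and all $(i,j)\in\mathcal E_t$. * (A6) The events $\{(i,j)\in E_t\}$, $i,j\in\mathcal V$, $t\ge0$, are independent, and there is $p^*\in(0,1)$ such that $\mathbb P((i,j)\in E_t)\le p^*$ for all $t\ge0$ and all $(i,j)\in\mathcal E_t$. * (A8) There is an integer $K\ge1$ such that for every $t\ge0$ the union graph $\bigl(\mathcal V,\bigcup_{\tau=t}^{t+K-1}\mathcal E_\tau^-\bigr)$ is weakly connected (i.e. connected once arc directions are forgotten). **Theorem.** Assume A1, A6 and A8, and let $\alpha\in[0,(2(n-1))^{-1})$, $\beta>0$ and $d\in(0,1)$ be fixed. Then there is $b_\star>0$ such that for every $b\in(0,1)$ with $b<b_\star$, $$\mathbb P\Bigl(\lim_{t\to\infty}\max_{i,j\in\mathcal V}|s_i(t)-s_j(t)|=\infty\Bigr)=1$$ for Lebesgue-almost every initial state $s(0)\in\mathbb R^n$. -/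

import Mathlib

open MeasureTheory ProbabilityTheory Filter

universe u

namespace SignedNetwork

/-- A simple signed digraph on `V`: each arc `(i, j)` (from `i` to `j`, `i ≠ j`) carries exactly
one sign, so it is either a positive arc or a negative arc. -/
structure SignedDigraph (V : Type*) where
  posArcs : Finset (V × V)
  negArcs : Finset (V × V)
  disjoint_signs : Disjoint posArcs negArcs
  loopless_pos : ∀ i, (i, i) ∉ posArcs
  loopless_neg : ∀ i, (i, i) ∉ negArcs

section Model

variable {V : Type*} [Fintype V] [DecidableEq V]

/-- All arcs of a signed digraph. -/
def SignedDigraph.arcs (G : SignedDigraph V) : Finset (V × V) := G.posArcs ∪ G.negArcs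

/-- The graph with arc set `A` is weakly connected: forgetting directions gives a connected
undirected graph. -/
def WeaklyConnected (A : Set (V × V)) : Prop :=
  (SimpleGraph.fromRel fun i j => (i, j) ∈ A).Connected

/-- At each time `t`, `μ t` only charges sets of arcs of `G t`. -/
def SupportedOn (G : ℕ → SignedDigraph V) (μ : ℕ → Measure (Finset (V × V))) : Prop :=
  ∀ t, ∀ᵐ A ∂(μ t), A ⊆ (G t).arcs

/-- The law of the sequence of interacting arc sets `(E_t)`: the product of the `μ t`. -/
noncomputable def interactionLaw (μ : ℕ → Measure (Finset (V × V))) :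
    Measure (ℕ → Finset (V × V)) :=
  Measure.infinitePi μ

/-- Every available arc is selected with probability at least `p_* ∈ (0, 1)`. -/
def ArcProbabilityBoundedBelow (G : ℕ → SignedDigraph V) (μ : ℕ → Measure (Finset (V × V))) : Prop :=
  ∃ p : ℝ, 0 < p ∧ p < 1 ∧ ∀ (t : ℕ) (i j : V), (i, j) ∈ (G t).arcs →
    p ≤ (interactionLaw μ).real {E | (i, j) ∈ E t}

/-- The events `(i, j) ∈ E_t`, over all `i`, `j` and `t`, are independent, and every
available arc is selected with probability at most `p^* ∈ (0, 1)`. -/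
def ArcsIndependentBoundedAbove (G : ℕ → SignedDigraph V) (μ : ℕ → Measure (Finset (V × V))) : Prop :=
  iIndepSet (fun (x : (V × V) × ℕ) => {E : ℕ → Finset (V × V) | x.1 ∈ E x.2})
      (interactionLaw μ) ∧
  ∃ p : ℝ, 0 < p ∧ p < 1 ∧ ∀ (t : ℕ) (i j : V), (i, j) ∈ (G t).arcs →
    (interactionLaw μ).real {E | (i, j) ∈ E t} ≤ p

/-- For some `K ≥ 1`, the union of the negative graphs over every window
`[t, t + K - 1]` is weakly connected. -/
def NegativeWindowsConnected (G : ℕ → SignedDigraph V) : Prop :=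
  ∃ K : ℕ, 1 ≤ K ∧ ∀ t : ℕ,
    WeaklyConnected {e : V × V | ∃ τ, t ≤ τ ∧ τ < t + K ∧ e ∈ (G τ).negArcs}

/-- `N_i^+`: the positive neighbours of `i` in the graph `G` when the arcs in `E` interact. -/
def posNeighbors (G : SignedDigraph V) (E : Finset (V × V)) (i : V) : Finset V :=
  {j | (j, i) ∈ E ∩ G.posArcs}

/-- `N_i^-`: the negative neighbours of `i` in the graph `G` when the arcs in `E` interact. -/
def negNeighbors (G : SignedDigraph V) (E : Finset (V × V)) (i : V) : Finset V :=
  {j | (j, i) ∈ E ∩ G.negArcs}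

/-- The positive recommendation `h_i^+` received by node `i` in state `s`. -/
noncomputable def posRecommendation (G : SignedDigraph V) (E : Finset (V × V)) (s : V → ℝ)
    (i : V) : ℝ :=
  -∑ j ∈ posNeighbors G E i, (s i - s j)

/-- The relative-state-reversion negative recommendation `h_i^-` received by node `i`. -/
noncomputable def negRecommendation (G : SignedDigraph V) (E : Finset (V × V)) (s : V → ℝ)
    (i : V) : ℝ :=
  ∑ j ∈ negNeighbors G E i, (s i - s j)

/-- The network state `s(t)` along one realization of the interacting arc sets `E t` and of the
attentions `B t`, `D t`, started at `s₀`. -/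
noncomputable def state (G : ℕ → SignedDigraph V) (α β : ℝ) (E : ℕ → Finset (V × V))
    (B D : ℕ → ℝ) (s₀ : V → ℝ) : ℕ → V → ℝ
  | 0 => s₀
  | t + 1 => fun i =>
      state G α β E B D s₀ t i
        + α * B t * posRecommendation (G t) (E t) (state G α β E B D s₀ t) i
        + β * D t * negRecommendation (G t) (E t) (state G α β E B D s₀ t) i

/-- `max_{i,j} |s_i - s_j|`, a supremum over a finite set of pairs. -/
noncomputable def maxGap (s : V → ℝ) : ℝ := ⨆ x : V × V, |s x.1 - s x.2|

/-- On the probability space `(Ω, P)`, the `E t` are independent arc sets with laws `μ t`, the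
`B t` are independent Bernoulli variables with means `b t`, the `D t` are independent Bernoulli
variables with means `d t`, and the three processes are mutually independent. -/
structure IsNetworkProcess {Ω : Type*} [MeasurableSpace Ω] (P : Measure Ω)
    (μ : ℕ → Measure (Finset (V × V))) (b d : ℕ → unitInterval)
    (E : ℕ → Ω → Finset (V × V)) (B D : ℕ → Ω → ℝ) : Prop where
  measurable_E : ∀ t, Measurable (E t)
  measurable_B : ∀ t, Measurable (B t)
  measurable_D : ∀ t, Measurable (D t)
  law_E : ∀ t, P.map (E t) = μ t
  law_B : ∀ t, P.map (B t) = bernoulliMeasure 1 0 (b t)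
  law_D : ∀ t, P.map (D t) = bernoulliMeasure 1 0 (d t)
  indep_E : iIndepFun E P
  indep_B : iIndepFun B P
  indep_D : iIndepFun D P
  indep_B_D : IndepFun (fun ω t => B t ω) (fun ω t => D t ω) P
  indep_E_BD : IndepFun (fun ω t => E t ω)
    (fun ω => ((fun t => B t ω : ℕ → ℝ), (fun t => D t ω : ℕ → ℝ))) P

end Model

end SignedNetwork

/-! The reciprocal gap `invGap` serves as a Lyapunov function: over windows of a fixed length `L`,
its expectation contracts by a factor below 1, uniformly in the starting time and state.

Fix the state at the start of a window. In each block of `K` steps, weak connectivity yields a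
negative arc carrying at least 1/n of the gap of that state; among n²m blocks, pigeonhole makes one
arc recur m times (`exists_recurring_arc`). If this arc interacts alone whenever it is negative,
nothing interacts at other times, and `D = 1` throughout, then the difference across it grows by at
least (1+β)^m ≥ 2n, so the gap doubles. This pattern has probability at least (cd)^L, a bound free
of b. In any case the gap cannot shrink unless some `B = 1` in the window, an event of probability
at most Lb, and even then a fraction κ^L survives, where κ = 1 - 2α(n-1) > 0. Hence the expected
reciprocal gap is multiplied by at most 1 - (cd)^L/2 + κ^(-L)Lb (`lintegral_invGap_window_le`),
which is below 1 for small b.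

Each window is independent of the past (`indepFun_state_window`), so the expectations decay
geometrically, the reciprocal gaps at multiples of `L` are almost surely summable, and the gap
diverges along these times; in between it loses at most the factor κ^L. Only a positive initial gap
is needed, and that holds off a hyperplane. -/

namespace SignedNetwork

/-! ### Pathwise bounds on the gap. -/

section Deterministic

variable {V : Type*}

theorem maxGap_nonneg (s : V → ℝ) : 0 ≤ maxGap s :=
  Real.iSup_nonneg fun _ => abs_nonneg _

theorem WeaklyConnected.mono {A A' : Set (V × V)} (hA : WeaklyConnected A) (h : A ⊆ A') :
    WeaklyConnected A' :=
  SimpleGraph.Connected.mono (fun _ _ hab => by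
    rw [SimpleGraph.fromRel_adj] at hab ⊢
    exact ⟨hab.1, hab.2.imp (fun h' => h h') fun h' => h h'⟩) hA

/-- The arc sets in which `e` interacts alone whenever it is a negative arc. -/
def soloArc [DecidableEq V] (G : ℕ → SignedDigraph V) (e : V × V) (t : ℕ) : Finset (V × V) :=
  if e ∈ (G t).negArcs then {e} else ∅

theorem soloArc_subset [DecidableEq V] (G : ℕ → SignedDigraph V) (e : V × V) (t : ℕ) :
    soloArc G e t ⊆ (G t).arcs := by
  unfold soloArc
  split_ifs with h
  · exact Finset.singleton_subset_iff.2 (Finset.mem_union_right _ h)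
  · exact Finset.empty_subset _

variable [Fintype V]

theorem bddAbove_range_gap (s : V → ℝ) :
    BddAbove (Set.range fun x : V × V => |s x.1 - s x.2|) :=
  (Set.finite_range _).bddAbove

theorem abs_sub_le_maxGap (s : V → ℝ) (i j : V) : |s i - s j| ≤ maxGap s :=
  le_ciSup (bddAbove_range_gap s) (i, j)

/-- The maximal gap is attained at a pair consisting of a largest and a smallest state. -/
theorem exists_maxGap_eq [Nonempty V] (s : V → ℝ) :
    ∃ i j, maxGap s = s i - s j ∧ ∀ k, s j ≤ s k ∧ s k ≤ s i := by
  obtain ⟨i, hi⟩ := Finite.exists_max s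
  obtain ⟨j, hj⟩ := Finite.exists_min s
  refine ⟨i, j, le_antisymm (ciSup_le fun x => ?_) ?_, fun k => ⟨hj k, hi k⟩⟩
  · exact abs_sub_le_iff.2 ⟨by linarith [hi x.1, hj x.2], by linarith [hi x.2, hj x.1]⟩
  · exact (le_abs_self _).trans (abs_sub_le_maxGap s i j)

theorem measurable_maxGap : Measurable (maxGap : (V → ℝ) → ℝ) := by
  unfold maxGap
  refine Measurable.iSup fun x => ?_
  fun_prop

/-- Some arc of a weakly connected graph carries a definite fraction of the maximal gap. -/
theorem exists_arc_maxGap_le {A : Set (V × V)} (hA : WeaklyConnected A) {s : V → ℝ}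
    (hs : 0 < maxGap s) :
    ∃ e ∈ A, maxGap s ≤ Fintype.card V * |s e.2 - s e.1| := by
  -- If every arc carried less than 1/n of the gap, a path between the extremal nodes, having at
  -- most n - 1 arcs, could not span the gap.
  by_contra! hlt
  have hadj : ∀ a b, (SimpleGraph.fromRel fun i j => (i, j) ∈ A).Adj a b →
      Fintype.card V * |s a - s b| ≤ maxGap s := by
    intro a b hab
    rw [SimpleGraph.fromRel_adj] at hab
    rcases hab.2 with h | h
    · rw [abs_sub_comm]
      exact (hlt _ h).le
    · exact (hlt _ h).le
  have hwalk : ∀ a b (p : (SimpleGraph.fromRel fun i j => (i, j) ∈ A).Walk a b),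
      Fintype.card V * |s a - s b| ≤ p.length * maxGap s := by
    intro a b p
    induction p with
    | nil => simp
    | @cons a b c h p ih =>
      have h1 := hadj _ _ h
      have h2 : Fintype.card V * |s a - s c| ≤
          Fintype.card V * (|s a - s b| + |s b - s c|) :=
        mul_le_mul_of_nonneg_left (abs_sub_le _ _ _) (Nat.cast_nonneg _)
      rw [SimpleGraph.Walk.length_cons]
      push_cast
      linarith
  have : Nonempty V := hA.nonempty
  obtain ⟨i, j, hij, -⟩ := exists_maxGap_eq s
  obtain ⟨p, hp⟩ := hA.preconnected.exists_isPath i j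
  have h1 := hwalk i j p
  have h2 : (p.length : ℝ) + 1 ≤ Fintype.card V := by exact_mod_cast hp.length_lt
  rw [← hij, abs_of_pos hs] at h1
  have := mul_le_mul_of_nonneg_right h2 hs.le
  linarith

variable [DecidableEq V]

/-- One update of the network state. -/
noncomputable def update (G : SignedDigraph V) (α β : ℝ) (A : Finset (V × V)) (b d : ℝ)
    (s : V → ℝ) : V → ℝ :=
  fun i => s i + α * b * posRecommendation G A s i + β * d * negRecommendation G A s i

theorem state_succ (G : ℕ → SignedDigraph V) (α β : ℝ) (E : ℕ → Finset (V × V))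
    (B D : ℕ → ℝ) (s : V → ℝ) (t : ℕ) :
    state G α β E B D s (t + 1) = update (G t) α β (E t) (B t) (D t) (state G α β E B D s t) :=
  rfl

theorem state_add (G : ℕ → SignedDigraph V) (α β : ℝ) (E : ℕ → Finset (V × V))
    (B D : ℕ → ℝ) (s : V → ℝ) (T r : ℕ) :
    state G α β E B D s (T + r) =
      state (fun t => G (T + t)) α β (fun t => E (T + t)) (fun t => B (T + t))
        (fun t => D (T + t)) (state G α β E B D s T) r := by
  induction r with
  | zero => rfl
  | succ r ih => rw [← add_assoc, state_succ, ih, state_succ]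

theorem state_congr (G : ℕ → SignedDigraph V) (α β : ℝ) {E E' : ℕ → Finset (V × V)}
    {B B' D D' : ℕ → ℝ} (s : V → ℝ) {T : ℕ} (hE : ∀ t < T, E t = E' t)
    (hB : ∀ t < T, B t = B' t) (hD : ∀ t < T, D t = D' t) :
    state G α β E B D s T = state G α β E' B' D' s T := by
  induction T with
  | zero => rfl
  | succ T ih =>
    rw [state_succ, state_succ, hE T (by omega), hB T (by omega), hD T (by omega),
      ih (fun t h => hE t (by omega)) (fun t h => hB t (by omega)) (fun t h => hD t (by omega))]

theorem card_posNeighbors_le (G : SignedDigraph V) (A : Finset (V × V)) (i : V) :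
    ((posNeighbors G A i).card : ℝ) ≤ Fintype.card V - 1 := by
  have h : posNeighbors G A i ⊆ Finset.univ.erase i := by
    intro j hj
    refine Finset.mem_erase.2 ⟨?_, Finset.mem_univ _⟩
    rintro rfl
    simp only [posNeighbors, Finset.mem_filter_univ, Finset.mem_inter] at hj
    exact G.loopless_pos _ hj.2
  have h1 := Finset.card_le_card h
  have h2 := Finset.card_erase_add_one (Finset.mem_univ i)
  rw [Finset.card_univ] at h2
  have h3 : (posNeighbors G A i).card + 1 ≤ Fintype.card V := by omega
  have h4 : ((posNeighbors G A i).card : ℝ) + 1 ≤ Fintype.card V := by exact_mod_cast h3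
  linarith

/-- Negative interactions never shrink the maximal gap, positive ones shrink it by a bounded
factor. -/
theorem mul_maxGap_le_maxGap_update (G : SignedDigraph V) {α β b d : ℝ} (hα : 0 ≤ α) (hβ : 0 ≤ β)
    (hb : 0 ≤ b) (hd : 0 ≤ d) (A : Finset (V × V)) (s : V → ℝ) :
    (1 - 2 * α * b * (Fintype.card V - 1)) * maxGap s ≤ maxGap (update G α β A b d s) := by
  rcases isEmpty_or_nonempty V with hV | hV
  · simp [maxGap]
  obtain ⟨i, j, hij, hk⟩ := exists_maxGap_eq s
  have hsum : ∀ k, ∑ l ∈ posNeighbors G A k, maxGap s ≤ (Fintype.card V - 1) * maxGap s := by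
    intro k
    rw [Finset.sum_const, nsmul_eq_mul]
    exact mul_le_mul_of_nonneg_right (card_posNeighbors_le G A k) (maxGap_nonneg s)
  have hi1 : -((Fintype.card V - 1) * maxGap s) ≤ posRecommendation G A s i := by
    refine neg_le_neg ((Finset.sum_le_sum fun l _ => ?_).trans (hsum i))
    linarith [(hk l).1]
  have hj1 : posRecommendation G A s j ≤ (Fintype.card V - 1) * maxGap s := by
    unfold posRecommendation
    rw [← Finset.sum_neg_distrib]
    refine (Finset.sum_le_sum fun l _ => ?_).trans (hsum j)
    linarith [(hk l).2]
  have hi2 : 0 ≤ negRecommendation G A s i :=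
    Finset.sum_nonneg fun l _ => sub_nonneg.2 (hk l).2
  have hj2 : negRecommendation G A s j ≤ 0 :=
    Finset.sum_nonpos fun l _ => sub_nonpos.2 (hk l).1
  -- It is enough to follow the old extremal pair: negative terms push its two nodes apart, and
  -- positive ones move each inward by at most α b (n-1) times the gap.
  refine le_trans ?_ ((le_abs_self _).trans (abs_sub_le_maxGap _ i j))
  have hαb : 0 ≤ α * b := mul_nonneg hα hb
  have hβd : 0 ≤ β * d := mul_nonneg hβ hd
  have e1 := mul_le_mul_of_nonneg_left hi1 hαb
  have e2 := mul_le_mul_of_nonneg_left hj1 hαb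
  have e3 := mul_nonneg hβd hi2
  have e4 := mul_nonpos_of_nonneg_of_nonpos hβd hj2
  unfold update
  linarith

theorem update_empty (G : SignedDigraph V) (α β b d : ℝ) (s : V → ℝ) :
    update G α β ∅ b d s = s := by
  funext i
  simp [update, posRecommendation, negRecommendation, posNeighbors, negNeighbors]

/-- A single negative arc expands the difference between its endpoints. -/
theorem update_singleton_sub (G : SignedDigraph V) (α β b : ℝ) (s : V → ℝ) {i j : V}
    (h : (j, i) ∈ G.negArcs) :
    update G α β {(j, i)} b 1 s i - update G α β {(j, i)} b 1 s j = (1 + β) * (s i - s j) := by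
  have hne : j ≠ i := by
    rintro rfl
    exact G.loopless_neg _ h
  have hpos : ∀ k, posNeighbors G {(j, i)} k = ∅ := by
    intro k
    ext l
    simp only [posNeighbors, Finset.mem_filter_univ, Finset.mem_inter, Finset.mem_singleton,
      Finset.notMem_empty, iff_false]
    rintro ⟨h1, h2⟩
    exact Finset.disjoint_left.1 G.disjoint_signs h2 (h1 ▸ h)
  have hi : negNeighbors G {(j, i)} i = {j} := by
    ext l
    simp only [negNeighbors, Finset.mem_filter_univ, Finset.mem_inter, Finset.mem_singleton,
      Prod.mk.injEq, and_true]
    exact ⟨fun h => h.1, fun h' => ⟨h', h' ▸ h⟩⟩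
  have hj : negNeighbors G {(j, i)} j = ∅ := by
    ext l
    simp [negNeighbors, hne]
  simp only [update, posRecommendation, negRecommendation, hpos, hi, hj, Finset.sum_singleton,
    Finset.sum_empty]
  ring

/-- `B` is unconstrained because no positive arc ever interacts; this is what keeps the probability
of growth independent of b. -/
theorem state_soloArc_sub (G : ℕ → SignedDigraph V) (α β : ℝ) (e : V × V) {T : ℕ}
    {E : ℕ → Finset (V × V)} {B D : ℕ → ℝ} (s : V → ℝ) (hE : ∀ t < T, E t = soloArc G e t)
    (hD : ∀ t < T, D t = 1) :
    state G α β E B D s T e.2 - state G α β E B D s T e.1 =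
      (1 + β) ^ ((Finset.range T).filter fun t => e ∈ (G t).negArcs).card * (s e.2 - s e.1) := by
  induction T with
  | zero => simp [state]
  | succ T ih =>
    have ih := ih (fun t h => hE t (by omega)) (fun t h => hD t (by omega))
    rw [state_succ, hE T (by omega), hD T (by omega), Finset.range_add_one, Finset.filter_insert,
      soloArc]
    split_ifs with h
    · rw [Finset.card_insert_of_notMem (by simp), pow_succ', mul_assoc, ← ih]
      exact update_singleton_sub (G T) α β (B T) _ h
    · rw [update_empty, ih]

/-- Some arc with a definite fraction of the gap recurs often in a long enough window. -/
theorem exists_recurring_arc {G : ℕ → SignedDigraph V} {K : ℕ}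
    (hK : ∀ t, WeaklyConnected {e : V × V | ∃ τ, t ≤ τ ∧ τ < t + K ∧ e ∈ (G τ).negArcs})
    {m : ℕ} (hm : 1 ≤ m) {s : V → ℝ} (hs : 0 < maxGap s) :
    ∃ e : V × V, maxGap s ≤ Fintype.card V * |s e.2 - s e.1| ∧
      m ≤ ((Finset.range (Fintype.card (V × V) * m * K)).filter
        fun t => e ∈ (G t).negArcs).card := by
  -- All blocks are tested against the same state `s`, not the evolving one, so the recurring arc
  -- still carries its share of the initial gap.
  choose f hf hgap using fun w : ℕ => exists_arc_maxGap_le (hK (w * K)) hs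
  choose τ hτ₁ hτ₂ hτ₃ using hf
  have : Nonempty V := (hK 0).nonempty
  obtain ⟨e, he⟩ := Fintype.exists_le_card_fiber_of_mul_le_card
    (fun w : Fin (Fintype.card (V × V) * m) => f w) (n := m) (by simp)
  refine ⟨e, ?_, he.trans ?_⟩
  · obtain ⟨w, hw⟩ := Finset.card_pos.1 (hm.trans he)
    rw [Finset.mem_filter_univ] at hw
    exact hw ▸ hgap w
  · refine Finset.card_le_card_of_injOn (fun w => τ w) (fun w hw => ?_) (fun w _ w' _ h => ?_)
    · have hw : f w = e := by simpa using hw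
      have h1 := hτ₂ w
      have h2 : ((w : ℕ) + 1) * K ≤ Fintype.card (V × V) * m * K :=
        Nat.mul_le_mul_right K w.2
      simp only [Finset.coe_filter, Finset.mem_range, Set.mem_ofPred_eq]
      exact ⟨by linarith, hw ▸ hτ₃ w⟩
    · have key : ∀ a b : ℕ, a < b → τ a < τ b := fun a b hab => by
        have h2 : (a + 1) * K ≤ b * K := Nat.mul_le_mul_right K hab
        linarith [hτ₂ a, hτ₁ b]
      refine Fin.ext ?_
      rcases lt_trichotomy (w : ℕ) w' with h' | h' | h'
      · exact absurd h (key _ _ h').ne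
      · exact h'
      · exact absurd h (key _ _ h').ne'

/-- The gap doubles if the right arc interacts alone over a long enough window. -/
theorem exists_soloArc_two_mul_maxGap_le {G : ℕ → SignedDigraph V} {K m : ℕ} {α β : ℝ}
    (hK : ∀ t, WeaklyConnected {e : V × V | ∃ τ, t ≤ τ ∧ τ < t + K ∧ e ∈ (G τ).negArcs})
    (hβ : 0 ≤ β) (hm : 2 * Fintype.card V ≤ (1 + β) ^ m) (hm₀ : 1 ≤ m) (s : V → ℝ)
    (hs : 0 < maxGap s) :
    ∃ e : V × V, ∀ (E : ℕ → Finset (V × V)) (B D : ℕ → ℝ),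
      (∀ t < Fintype.card (V × V) * m * K, E t = soloArc G e t) →
      (∀ t < Fintype.card (V × V) * m * K, D t = 1) →
      2 * maxGap s ≤ maxGap (state G α β E B D s (Fintype.card (V × V) * m * K)) := by
  have : Nonempty V := (hK 0).nonempty
  obtain ⟨e, he, hcard⟩ := exists_recurring_arc hK hm₀ hs
  refine ⟨e, fun E B D hE hD => ?_⟩
  have h1 := abs_sub_le_maxGap (state G α β E B D s (Fintype.card (V × V) * m * K)) e.2 e.1
  rw [state_soloArc_sub G α β e s hE hD, abs_mul, abs_of_nonneg (by positivity)] at h1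
  refine le_trans ?_ h1
  -- A growth factor of 2n makes up for the arc carrying only 1/n of the gap.
  have h2 := hm.trans (pow_le_pow_right₀ (by linarith) hcard)
  have h3 := mul_le_mul_of_nonneg_right h2 (abs_nonneg (s e.2 - s e.1))
  linarith

/-- Counting only the times with `B t = 1` gives both bounds used later: no loss when there are
none, and a loss of at most κ^T in general when κ ≤ 1. -/
theorem pow_mul_maxGap_le_maxGap_state (G : ℕ → SignedDigraph V) {α β κ : ℝ} (hα : 0 ≤ α)
    (hβ : 0 ≤ β) (hκ : 0 ≤ κ) (hκ₁ : κ ≤ 1 - 2 * α * (Fintype.card V - 1))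
    {E : ℕ → Finset (V × V)} {B D : ℕ → ℝ} (s : V → ℝ)
    (hB : ∀ t, B t = 0 ∨ B t = 1) (hD : ∀ t, 0 ≤ D t) (T : ℕ) :
    κ ^ ((Finset.range T).filter fun t => B t = 1).card * maxGap s ≤
      maxGap (state G α β E B D s T) := by
  induction T with
  | zero => simp [state]
  | succ T ih =>
    have hBT : 0 ≤ B T := by rcases hB T with h | h <;> simp [h]
    have h1 := mul_maxGap_le_maxGap_update (G T) hα hβ hBT (hD T) (E T) (state G α β E B D s T)
    rw [state_succ, Finset.range_add_one, Finset.filter_insert]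
    refine le_trans ?_ h1
    split_ifs with h
    · rw [Finset.card_insert_of_notMem (by simp), pow_succ', mul_assoc, h, mul_one]
      exact mul_le_mul hκ₁ ih (mul_nonneg (pow_nonneg hκ _) (maxGap_nonneg s)) (hκ.trans hκ₁)
    · rw [(hB T).resolve_right h]
      simpa using ih

end Deterministic

/-! ### Independence of the past and a future window. -/

section Independence

variable {Ω : Type*} [MeasurableSpace Ω] {P : Measure Ω}

/-- If `(X₁, X₂)` and `(Y₁, Y₂)` are independent pairs, each with independent entries, then
`(X₁, Y₁)` and `(X₂, Y₂)` are independent. -/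
theorem indepFun_prodMk_prodMk_of_indepFun [IsProbabilityMeasure P] {α₁ α₂ β₁ β₂ : Type*}
    [MeasurableSpace α₁] [MeasurableSpace α₂] [MeasurableSpace β₁] [MeasurableSpace β₂]
    {X₁ : Ω → α₁} {X₂ : Ω → α₂} {Y₁ : Ω → β₁} {Y₂ : Ω → β₂}
    (mX₁ : Measurable X₁) (mX₂ : Measurable X₂) (mY₁ : Measurable Y₁) (mY₂ : Measurable Y₂)
    (hX : IndepFun X₁ X₂ P) (hY : IndepFun Y₁ Y₂ P)
    (h : IndepFun (fun ω => (X₁ ω, X₂ ω)) (fun ω => (Y₁ ω, Y₂ ω)) P) :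
    IndepFun (fun ω => (X₁ ω, Y₁ ω)) (fun ω => (X₂ ω, Y₂ ω)) P := by
  have hrect : ∀ s₁ s₂ t₁ t₂, MeasurableSet s₁ → MeasurableSet s₂ → MeasurableSet t₁ →
      MeasurableSet t₂ → P ((X₁ ⁻¹' s₁ ∩ X₂ ⁻¹' s₂) ∩ (Y₁ ⁻¹' t₁ ∩ Y₂ ⁻¹' t₂)) =
        P (X₁ ⁻¹' s₁) * P (X₂ ⁻¹' s₂) * (P (Y₁ ⁻¹' t₁) * P (Y₂ ⁻¹' t₂)) := by
    intro s₁ s₂ t₁ t₂ hs₁ hs₂ ht₁ ht₂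
    have := h.measure_inter_preimage_eq_mul (s₁ ×ˢ s₂) (t₁ ×ˢ t₂) (hs₁.prod hs₂) (ht₁.prod ht₂)
    rw [Set.mk_preimage_prod, Set.mk_preimage_prod, hX.measure_inter_preimage_eq_mul _ _ hs₁ hs₂,
      hY.measure_inter_preimage_eq_mul _ _ ht₁ ht₂] at this
    exact this
  rw [IndepFun_iff_Indep]
  refine IndepSets.indep (mX₁.prodMk mY₁).comap_le (mX₂.prodMk mY₂).comap_le
    (isPiSystem_prod.comap fun ω => (X₁ ω, Y₁ ω)) (isPiSystem_prod.comap fun ω => (X₂ ω, Y₂ ω))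
    ?_ ?_ ?_
  · rw [← generateFrom_prod, MeasurableSpace.comap_generateFrom]
    rfl
  · rw [← generateFrom_prod, MeasurableSpace.comap_generateFrom]
    rfl
  · rw [IndepSets_iff]
    rintro _ _ ⟨_, ⟨s₁, hs₁, t₁, ht₁, rfl⟩, rfl⟩ ⟨_, ⟨s₂, hs₂, t₂, ht₂, rfl⟩, rfl⟩
    have hs₁ : MeasurableSet s₁ := hs₁
    have hs₂ : MeasurableSet s₂ := hs₂
    have ht₁ : MeasurableSet t₁ := ht₁
    have ht₂ : MeasurableSet t₂ := ht₂
    rw [Set.mk_preimage_prod, Set.mk_preimage_prod, Set.inter_inter_inter_comm,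
      hrect _ _ _ _ hs₁ hs₂ ht₁ ht₂]
    -- Full sets in the rectangle formula recover the laws of the two regrouped pairs.
    have h1 := hrect s₁ Set.univ t₁ Set.univ hs₁ .univ ht₁ .univ
    have h2 := hrect Set.univ s₂ Set.univ t₂ .univ hs₂ .univ ht₂
    simp only [Set.preimage_univ, Set.inter_univ, Set.univ_inter, measure_univ, mul_one,
      one_mul] at h1 h2
    rw [h1, h2, mul_mul_mul_comm]

/-- The first `L` terms of a sequence, continued by a default value. -/
def truncate {β : Type*} [Inhabited β] (L : ℕ) (x : ℕ → β) (t : ℕ) : β :=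
  if t < L then x t else default

theorem truncate_of_lt {β : Type*} [Inhabited β] {L t : ℕ} (h : t < L) (x : ℕ → β) :
    truncate L x t = x t :=
  if_pos h

theorem measurable_truncate {β : Type*} [Inhabited β] [MeasurableSpace β] (L : ℕ) :
    Measurable (truncate (β := β) L) := by
  refine measurable_pi_iff.2 fun t => ?_
  unfold truncate
  split_ifs
  · exact measurable_pi_apply t
  · exact measurable_const

theorem measurable_truncate_shift {β : Type*} [Inhabited β] [MeasurableSpace β] (T L : ℕ) :
    Measurable fun x : ℕ → β => truncate L fun t => x (T + t) :=
  (measurable_truncate L).comp (measurable_pi_iff.2 fun t => measurable_pi_apply (T + t))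

/-- The two sides read disjoint index sets. Padding with a default keeps them infinite sequences, so
that `state` can be evaluated on them. -/
theorem indepFun_truncate {β : Type*} [Inhabited β] [MeasurableSpace β] {X : ℕ → Ω → β}
    (hX : iIndepFun X P) (mX : ∀ t, Measurable (X t)) (T L : ℕ) :
    IndepFun (fun ω => truncate T fun t => X t ω) (fun ω => truncate L fun t => X (T + t) ω) P := by
  have h := hX.indepFun_finset (Finset.range T) (Finset.Ico T (T + L))
    (by
      rw [Finset.disjoint_left]
      intro a h1 h2
      simp only [Finset.mem_range, Finset.mem_Ico] at h1 h2
      omega) mX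
  let f : ((Finset.range T) → β) → ℕ → β := fun x t =>
    if ht : t ∈ Finset.range T then x ⟨t, ht⟩ else default
  let g : ((Finset.Ico T (T + L)) → β) → ℕ → β := fun x t =>
    if ht : T + t ∈ Finset.Ico T (T + L) then x ⟨T + t, ht⟩ else default
  have mf : Measurable f := by
    refine measurable_pi_iff.2 fun t => ?_
    by_cases ht : t ∈ Finset.range T
    · simpa only [f, dif_pos ht] using measurable_pi_apply _
    · simpa only [f, dif_neg ht] using measurable_const
  have mg : Measurable g := by
    refine measurable_pi_iff.2 fun t => ?_
    by_cases ht : T + t ∈ Finset.Ico T (T + L)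
    · simpa only [g, dif_pos ht] using measurable_pi_apply _
    · simpa only [g, dif_neg ht] using measurable_const
  convert h.comp mf mg using 1
  · funext ω t
    simp [f, truncate]
  · funext ω t
    simp [g, truncate]

/-- Integrating a function of two independent variables by freezing the first one. -/
theorem lintegral_of_indepFun [IsProbabilityMeasure P] {α β : Type*} [MeasurableSpace α]
    [MeasurableSpace β] {X : Ω → α} {Z : Ω → β} (mX : Measurable X) (mZ : Measurable Z)
    (h : IndepFun X Z P) {F : α → β → ENNReal} (mF : Measurable (Function.uncurry F)) :
    ∫⁻ ω, F (X ω) (Z ω) ∂P = ∫⁻ ω, ∫⁻ ω', F (X ω) (Z ω') ∂P ∂P := by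
  have h1 := (indepFun_iff_map_prod_eq_prod_map_map mX.aemeasurable mZ.aemeasurable).1 h
  have := Measure.isProbabilityMeasure_map (μ := P) mX.aemeasurable
  have := Measure.isProbabilityMeasure_map (μ := P) mZ.aemeasurable
  calc ∫⁻ ω, F (X ω) (Z ω) ∂P
      = ∫⁻ p, Function.uncurry F p ∂(P.map fun ω => (X ω, Z ω)) :=
        (lintegral_map mF (mX.prodMk mZ)).symm
    _ = ∫⁻ x, ∫⁻ z, F x z ∂(P.map Z) ∂(P.map X) := by
        rw [h1, lintegral_prod _ mF.aemeasurable]; rfl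
    _ = ∫⁻ ω, ∫⁻ z, F (X ω) z ∂(P.map Z) ∂P := by
        exact lintegral_map mF.lintegral_prod_right' mX
    _ = ∫⁻ ω, ∫⁻ ω', F (X ω) (Z ω') ∂P ∂P := by
        refine lintegral_congr fun ω => ?_
        exact lintegral_map (mF.comp measurable_prodMk_left) mZ

end Independence

/-! ### A lower bound for the probability of any prescribed arc set. -/

section ArcLaw

variable {V : Type*} [Fintype V]

theorem measurableSet_mem_arcs (e : V × V) (t : ℕ) :
    MeasurableSet {E : ℕ → Finset (V × V) | e ∈ E t} :=
  measurableSet_preimage (f := fun E : ℕ → Finset (V × V) => E t) (measurable_pi_apply t)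
    (t := {A : Finset (V × V) | e ∈ A}) .of_discrete

/-- Every set of available arcs is selected with probability bounded away from zero. -/
theorem exists_forall_le_real_singleton [DecidableEq V] {G : ℕ → SignedDigraph V}
    {μ : ℕ → Measure (Finset (V × V))} [∀ t, IsProbabilityMeasure (μ t)]
    (hμ : SupportedOn G μ) (hA1 : ArcProbabilityBoundedBelow G μ)
    (hA6 : ArcsIndependentBoundedAbove G μ) :
    ∃ c : ℝ, 0 < c ∧ c ≤ 1 ∧ ∀ t (S : Finset (V × V)), S ⊆ (G t).arcs → c ≤ (μ t).real {S} := by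
  obtain ⟨p, hp₀, hp₁, hp⟩ := hA1
  obtain ⟨hind, q, hq₀, hq₁, hq⟩ := hA6
  have hprob : IsProbabilityMeasure (interactionLaw μ) := by
    unfold interactionLaw; infer_instance
  have hc₀ : 0 < min p (1 - q) := lt_min hp₀ (by linarith)
  have hc₁ : min p (1 - q) ≤ 1 := (min_le_left _ _).trans hp₁.le
  have heval : ∀ t (A : Set (Finset (V × V))), (μ t).real A = (interactionLaw μ).real
      {E | E t ∈ A} := by
    intro t A
    have := Measure.infinitePi_map_eval μ t
    rw [← this, map_measureReal_apply (measurable_pi_apply t) .of_discrete]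
    rfl
  -- One factor per ordered pair: at least p for a selected arc, at least 1 - q for an omitted one,
  -- and exactly 1 for a pair that is not an arc.
  refine ⟨min p (1 - q) ^ Fintype.card (V × V), pow_pos hc₀ _, pow_le_one₀ hc₀.le hc₁,
    fun t S hS => ?_⟩
  let F : V × V → Set (ℕ → Finset (V × V)) := fun e =>
    if e ∈ S then {E | e ∈ E t} else {E | e ∈ E t}ᶜ
  have hF : {E : ℕ → Finset (V × V) | E t ∈ ({S} : Set _)} = ⋂ e ∈ Finset.univ, F e := by
    ext E
    simp only [Set.mem_singleton_iff, Set.mem_ofPred_eq, Finset.mem_univ, Set.iInter_true,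
      Set.mem_iInter, F]
    refine ⟨fun h e => ?_, fun h => ?_⟩
    · split_ifs with he
      · exact (h ▸ he : e ∈ E t)
      · exact (h ▸ he : e ∉ E t)
    · ext e
      have := h e
      split_ifs at this with he
      · exact iff_of_true this he
      · exact iff_of_false this he
  have hind' : iIndepSet (fun e : V × V => {E : ℕ → Finset (V × V) | e ∈ E t})
      (interactionLaw μ) :=
    iIndep.precomp (g := fun e : V × V => (e, t)) (fun a b h => (Prod.mk.inj h).1) hind
  rw [heval, hF, measureReal_def, ((iIndepSet_iff_iIndep _ _).1 hind').meas_biInter, ENNReal.toReal_prod,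
    ← Finset.card_univ, ← Finset.prod_const]
  · refine Finset.prod_le_prod (fun _ _ => hc₀.le) fun e _ => ?_
    simp only [F]
    split_ifs with he
    · exact (min_le_left _ _).trans (hp t e.1 e.2 (hS he))
    · rw [← measureReal_def, probReal_compl_eq_one_sub (measurableSet_mem_arcs e t)]
      by_cases hea : e ∈ (G t).arcs
      · refine (min_le_right _ _).trans ?_
        have := hq t e.1 e.2 hea
        linarith
      · have h0 : (interactionLaw μ).real {E | e ∈ E t} = 0 := by
          refine (heval t {A | e ∈ A}).symm.trans ?_
          rw [measureReal_eq_zero_iff, measure_eq_zero_iff_ae_notMem]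
          filter_upwards [hμ t] with A hA h using hea (hA h)
        rw [h0]
        linarith
  · intro e _
    have hgen : MeasurableSet[MeasurableSpace.generateFrom {{E : ℕ → Finset (V × V) | e ∈ E t}}]
        {E : ℕ → Finset (V × V) | e ∈ E t} :=
      MeasurableSpace.measurableSet_generateFrom rfl
    simp only [F]
    split_ifs
    · exact hgen
    · exact hgen.compl

end ArcLaw

/-! ### Contraction of the expected reciprocal gap over one window. -/

section RandomStates

variable {V : Type*}

/-- The reciprocal of the maximal gap, infinite at consensus. -/
noncomputable def invGap (s : V → ℝ) : ENNReal := (ENNReal.ofReal (maxGap s))⁻¹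

theorem invGap_le_of_mul_le {s s' : V → ℝ} {g h : ℝ} (hg : 0 < g) (hs : g * maxGap s ≤ maxGap s')
    (hh : g⁻¹ ≤ h) : invGap s' ≤ invGap s * ENNReal.ofReal h := by
  have hg' : ENNReal.ofReal g ≠ 0 := by simpa using hg
  calc invGap s' ≤ (ENNReal.ofReal (g * maxGap s))⁻¹ :=
        ENNReal.inv_le_inv.2 (ENNReal.ofReal_le_ofReal hs)
    _ = invGap s * ENNReal.ofReal g⁻¹ := by
        rw [ENNReal.ofReal_mul hg.le, ENNReal.mul_inv (Or.inl hg') (Or.inl ENNReal.ofReal_ne_top),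
          ENNReal.ofReal_inv_of_pos hg, mul_comm, invGap]
    _ ≤ invGap s * ENNReal.ofReal h := by gcongr

theorem measurable_invGap [Fintype V] : Measurable (invGap : (V → ℝ) → ENNReal) :=
  measurable_maxGap.ennreal_ofReal.inv

variable {Ω : Type*} [MeasurableSpace Ω] {P : Measure Ω} {μ : ℕ → Measure (Finset (V × V))}
  {b d : unitInterval} {E : ℕ → Ω → Finset (V × V)} {B D : ℕ → Ω → ℝ}

namespace IsNetworkProcess

theorem ae_eq_zero_or_eq_one {X : ℕ → Ω → ℝ} {p : unitInterval} (mX : ∀ t, Measurable (X t))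
    (hX : ∀ t, P.map (X t) = bernoulliMeasure 1 0 p) : ∀ᵐ ω ∂P, ∀ t, X t ω = 0 ∨ X t ω = 1 := by
  refine ae_all_iff.2 fun t => ?_
  have hm : MeasurableSet ({0, 1} : Set ℝ) := (Set.toFinite _).measurableSet
  have h : ∀ᵐ x ∂(P.map (X t)), x ∈ ({0, 1} : Set ℝ) := by
    rw [hX t, ae_iff]
    exact bernoulliMeasure_apply_of_notMem_of_notMem p hm.compl (by simp) (by simp)
  exact ae_of_ae_map (mX t).aemeasurable h

theorem real_eq_one {X : Ω → ℝ} {p : unitInterval} (mX : Measurable X)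
    (hX : P.map X = bernoulliMeasure 1 0 p) : P.real {ω | X ω = 1} = p := by
  have h := map_measureReal_apply (μ := P) mX (measurableSet_singleton (1 : ℝ))
  rw [hX, bernoulliMeasure_real_apply_of_mem_of_notMem p (measurableSet_singleton _) (by simp)
    (by simp)] at h
  exact h.symm

theorem real_exists_eq_one_le (h : IsNetworkProcess P μ (fun _ => b) (fun _ => d) E B D)
    (T L : ℕ) : P.real {ω | ∃ t < L, B (T + t) ω = 1} ≤ L * b := by
  have h1 : {ω | ∃ t < L, B (T + t) ω = 1} = ⋃ t ∈ Finset.range L, {ω | B (T + t) ω = 1} := by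
    ext ω; simp
  rw [h1]
  refine (measureReal_biUnion_finset_le _ _).trans ?_
  rw [Finset.sum_congr rfl fun t _ => real_eq_one (h.measurable_B _) (h.law_B _)]
  simp

/-- The probability of a prescribed window of arc sets with full negative attention. -/
theorem pow_le_real_pattern [Fintype V] (h : IsNetworkProcess P μ (fun _ => b) (fun _ => d) E B D) {c : ℝ}
    (hc : 0 ≤ c) (T L : ℕ) {S : ℕ → Finset (V × V)} (hS : ∀ t < L, c ≤ (μ (T + t)).real {S t}) :
    (c * d) ^ L ≤ P.real {ω | (∀ t < L, E (T + t) ω = S t) ∧ ∀ t < L, D (T + t) ω = 1} := by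
  have hinj : Function.Injective fun t => T + t := add_right_injective T
  have hE : P.real {ω | ∀ t < L, E (T + t) ω = S t} = ∏ t ∈ Finset.range L,
      (μ (T + t)).real {S t} := by
    have h1 := (iIndepFun_iff_measure_inter_preimage_eq_mul.1 (h.indep_E.precomp hinj))
      (Finset.range L) (sets := fun t => {S t}) (fun t _ => .of_discrete)
    have h2 : {ω | ∀ t < L, E (T + t) ω = S t} =
        ⋂ t ∈ Finset.range L, E (T + t) ⁻¹' {S t} := by
      ext ω; simp
    rw [h2, measureReal_def, h1, ENNReal.toReal_prod]
    refine Finset.prod_congr rfl fun t _ => ?_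
    rw [← h.law_E, map_measureReal_apply (h.measurable_E _) .of_discrete]
    rfl
  have hD : P.real {ω | ∀ t < L, D (T + t) ω = 1} = (d : ℝ) ^ L := by
    have h1 := (iIndepFun_iff_measure_inter_preimage_eq_mul.1 (h.indep_D.precomp hinj))
      (Finset.range L) (sets := fun _ => {1}) (fun t _ => measurableSet_singleton _)
    have h2 : {ω | ∀ t < L, D (T + t) ω = 1} =
        ⋂ t ∈ Finset.range L, D (T + t) ⁻¹' {1} := by
      ext ω; simp
    rw [h2, measureReal_def, h1, ENNReal.toReal_prod, Finset.prod_congr rfl, Finset.prod_const,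
      Finset.card_range]
    exact fun t _ => real_eq_one (h.measurable_D _) (h.law_D _)
  have hED : P.real {ω | (∀ t < L, E (T + t) ω = S t) ∧ ∀ t < L, D (T + t) ω = 1} =
      P.real {ω | ∀ t < L, E (T + t) ω = S t} * P.real {ω | ∀ t < L, D (T + t) ω = 1} := by
    have hmE : MeasurableSet {e : ℕ → Finset (V × V) | ∀ t < L, e (T + t) = S t} := by
      have : {e : ℕ → Finset (V × V) | ∀ t < L, e (T + t) = S t} =
          ⋂ t ∈ Finset.range L, (fun e => e (T + t)) ⁻¹' {S t} := by ext; simp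
      rw [this]
      exact Finset.measurableSet_biInter _ fun t _ => measurable_pi_apply _ .of_discrete
    have hmD : MeasurableSet {x : (ℕ → ℝ) × (ℕ → ℝ) | ∀ t < L, x.2 (T + t) = 1} := by
      have : {x : (ℕ → ℝ) × (ℕ → ℝ) | ∀ t < L, x.2 (T + t) = 1} =
          ⋂ t ∈ Finset.range L, (fun x => x.2 (T + t)) ⁻¹' {1} := by ext; simp
      rw [this]
      exact Finset.measurableSet_biInter _ fun t _ =>
        ((measurable_pi_apply _).comp measurable_snd) (measurableSet_singleton _)
    have := h.indep_E_BD.measure_inter_preimage_eq_mul _ _ hmE hmD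
    rw [measureReal_def, measureReal_def, measureReal_def, ← ENNReal.toReal_mul]
    exact congrArg ENNReal.toReal this
  rw [hED, hE, hD, mul_pow]
  refine mul_le_mul_of_nonneg_right ?_ (pow_nonneg d.2.1 _)
  calc c ^ L = ∏ _t ∈ Finset.range L, c := by rw [Finset.prod_const, Finset.card_range]
    _ ≤ _ := Finset.prod_le_prod (fun _ _ => hc) fun t ht => hS t (Finset.mem_range.1 ht)

end IsNetworkProcess

variable [Fintype V] [DecidableEq V]

theorem measurable_update {S : Type*} [MeasurableSpace S] (G : SignedDigraph V) (α β : ℝ)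
    {A : S → Finset (V × V)} {b d : S → ℝ} {s : S → V → ℝ} (hA : Measurable A)
    (hb : Measurable b) (hd : Measurable d) (hs : Measurable s) :
    Measurable fun x => update G α β (A x) (b x) (d x) (s x) := by
  have hsi : ∀ i, Measurable fun x => s x i := measurable_pi_iff.1 hs
  have hite : ∀ (C : Finset (V × V)) i j,
      Measurable fun x => if (j, i) ∈ A x ∩ C then s x i - s x j else 0 := fun C i j =>
    Measurable.ite (measurableSet_preimage hA (t := {A | (j, i) ∈ A ∩ C}) .of_discrete)
      ((hsi i).sub (hsi j)) measurable_const
  refine measurable_pi_iff.2 fun i => ?_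
  simp only [update, posRecommendation, negRecommendation, posNeighbors, negNeighbors,
    Finset.sum_filter]
  have h1 := Finset.measurable_sum Finset.univ fun j _ => hite G.posArcs i j
  have h2 := Finset.measurable_sum Finset.univ fun j _ => hite G.negArcs i j
  exact ((hsi i).add ((hb.const_mul α).mul h1.neg)).add ((hd.const_mul β).mul h2)

theorem measurable_state {S : Type*} [MeasurableSpace S] (G : ℕ → SignedDigraph V) (α β : ℝ)
    {E : S → ℕ → Finset (V × V)} {B D : S → ℕ → ℝ} {s : S → V → ℝ} (hE : Measurable E)
    (hB : Measurable B) (hD : Measurable D) (hs : Measurable s) (T : ℕ) :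
    Measurable fun x => state G α β (E x) (B x) (D x) (s x) T := by
  induction T with
  | zero => exact hs
  | succ T ih =>
    exact measurable_update (G T) α β ((measurable_pi_apply T).comp hE)
      ((measurable_pi_apply T).comp hB) ((measurable_pi_apply T).comp hD) ih

namespace IsNetworkProcess

variable [IsProbabilityMeasure P]

/-- The state at time `T` depends only on the first `T` terms of each process. Past and window are
separated by regrouping first `B` with `D`, then `E` with that pair. -/
theorem indepFun_state_window (h : IsNetworkProcess P μ (fun _ => b) (fun _ => d) E B D)
    (G : ℕ → SignedDigraph V) (α β : ℝ) (s : V → ℝ) (T L : ℕ) :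
    IndepFun (fun ω => state G α β (fun t => E t ω) (fun t => B t ω) (fun t => D t ω) s T)
      (fun ω => (truncate L fun t => E (T + t) ω, truncate L fun t => B (T + t) ω,
        truncate L fun t => D (T + t) ω)) P := by
  have mE : Measurable fun ω t => E t ω := measurable_pi_iff.2 h.measurable_E
  have mB : Measurable fun ω t => B t ω := measurable_pi_iff.2 h.measurable_B
  have mD : Measurable fun ω t => D t ω := measurable_pi_iff.2 h.measurable_D
  have pastE := measurable_truncate (β := Finset (V × V)) T
  have winE := measurable_truncate_shift (β := Finset (V × V)) T L
  have past := measurable_truncate (β := ℝ) T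
  have win := measurable_truncate_shift (β := ℝ) T L
  have hBD := indepFun_prodMk_prodMk_of_indepFun (past.comp mB) (win.comp mB) (past.comp mD)
    (win.comp mD) (indepFun_truncate h.indep_B h.measurable_B T L)
    (indepFun_truncate h.indep_D h.measurable_D T L)
    (h.indep_B_D.comp (past.prodMk win) (past.prodMk win))
  have hEBD := indepFun_prodMk_prodMk_of_indepFun (pastE.comp mE) (winE.comp mE)
    ((past.comp mB).prodMk (past.comp mD)) ((win.comp mB).prodMk (win.comp mD))
    (indepFun_truncate h.indep_E h.measurable_E T L) hBD
    (h.indep_E_BD.comp (pastE.prodMk winE)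
      (((past.comp measurable_fst).prodMk (past.comp measurable_snd)).prodMk
        ((win.comp measurable_fst).prodMk (win.comp measurable_snd))))
  have mst : Measurable fun x : (ℕ → Finset (V × V)) × (ℕ → ℝ) × (ℕ → ℝ) =>
      state G α β x.1 x.2.1 x.2.2 s T :=
    measurable_state G α β measurable_fst (measurable_fst.comp measurable_snd)
      (measurable_snd.comp measurable_snd) measurable_const T
  have htr : (fun ω => state G α β (fun t => E t ω) (fun t => B t ω) (fun t => D t ω) s T) =
      fun ω => state G α β (truncate T fun t => E t ω) (truncate T fun t => B t ω)
        (truncate T fun t => D t ω) s T :=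
    funext fun ω => state_congr G α β s (fun t ht => (truncate_of_lt ht fun t => E t ω).symm)
      (fun t ht => (truncate_of_lt ht fun t => B t ω).symm)
      (fun t ht => (truncate_of_lt ht fun t => D t ω).symm)
  rw [htr]
  exact hEBD.comp mst measurable_id

/-- Over a window, the expected reciprocal gap from a fixed state contracts. -/
theorem lintegral_invGap_window_le (h : IsNetworkProcess P μ (fun _ => b) (fun _ => d) E B D)
    {G : ℕ → SignedDigraph V} {α β κ c : ℝ} (hα : 0 ≤ α) (hβ : 0 ≤ β) (hκ : 0 < κ)
    (hκ₁ : κ ≤ 1 - 2 * α * (Fintype.card V - 1)) (hκ₂ : κ ≤ 1) (hc : 0 ≤ c) {T L : ℕ}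
    (hμ : ∀ e t, c ≤ (μ (T + t)).real {soloArc (fun t => G (T + t)) e t}) {s : V → ℝ}
    (hgrow : ∃ e : V × V, ∀ (E : ℕ → Finset (V × V)) (B D : ℕ → ℝ),
      (∀ t < L, E t = soloArc (fun t => G (T + t)) e t) → (∀ t < L, D t = 1) →
      2 * maxGap s ≤ maxGap (state (fun t => G (T + t)) α β E B D s L)) :
    ∫⁻ ω, invGap (state (fun t => G (T + t)) α β (fun t => E (T + t) ω) (fun t => B (T + t) ω)
        (fun t => D (T + t) ω) s L) ∂P ≤
      ENNReal.ofReal (1 - (c * d) ^ L / 2 + (κ ^ L)⁻¹ * (L * b)) * invGap s := by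
  obtain ⟨e, he⟩ := hgrow
  let A : Set Ω := {ω | (∀ t < L, E (T + t) ω = soloArc (fun t => G (T + t)) e t) ∧
    ∀ t < L, D (T + t) ω = 1}
  let S : Set Ω := {ω | ∃ t < L, B (T + t) ω = 1}
  have mA : MeasurableSet A := by
    have : A = ⋂ t ∈ Finset.range L, E (T + t) ⁻¹' {soloArc (fun t => G (T + t)) e t} ∩
        D (T + t) ⁻¹' {1} := by
      ext ω
      simp [A, forall_and]
    rw [this]
    exact Finset.measurableSet_biInter _ fun t _ => ((h.measurable_E _) .of_discrete).inter
      ((h.measurable_D _) (measurableSet_singleton _))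
  have mS : MeasurableSet S := by
    have : S = ⋃ t ∈ Finset.range L, B (T + t) ⁻¹' {1} := by
      ext ω
      simp [S]
    rw [this]
    exact Finset.measurableSet_biUnion _ fun t _ =>
      (h.measurable_B _) (measurableSet_singleton _)
  have hκL : 0 < (κ ^ L)⁻¹ := inv_pos.2 (pow_pos hκ L)
  -- A single majorant for three cases: the reciprocal gap is at least halved on `A` (even inside
  -- `S`), grows by at most κ^(-L) on `S`, and does not increase elsewhere.
  let f : Ω → ℝ := fun ω => 1 - A.indicator 1 ω / 2 + (κ ^ L)⁻¹ * S.indicator 1 ω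
  have iA : Integrable (A.indicator (1 : Ω → ℝ)) P := (integrable_const 1).indicator mA
  have iS : Integrable (S.indicator (1 : Ω → ℝ)) P := (integrable_const 1).indicator mS
  have iA' : Integrable (fun ω => 1 - A.indicator (1 : Ω → ℝ) ω / 2) P :=
    (integrable_const 1).sub (iA.div_const 2)
  have hfi : Integrable f P := iA'.add (iS.const_mul _)
  have hf : ∫ ω, f ω ∂P = 1 - P.real A / 2 + (κ ^ L)⁻¹ * P.real S := by
    simp only [f]
    rw [integral_add iA' (iS.const_mul _),
      integral_sub (integrable_const 1) (iA.div_const 2), integral_div, integral_const_mul,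
      integral_indicator_one mA, integral_indicator_one mS]
    simp
  have hf₀ : ∀ ω, 0 ≤ f ω := by
    intro ω
    have h1 : A.indicator (1 : Ω → ℝ) ω ≤ 1 := Set.indicator_le_self' (by simp) ω
    have h2 : 0 ≤ S.indicator (1 : Ω → ℝ) ω := Set.indicator_nonneg (by simp) ω
    have h3 := mul_nonneg hκL.le h2
    simp only [f]
    linarith
  have key : ∀ᵐ ω ∂P, invGap (state (fun t => G (T + t)) α β (fun t => E (T + t) ω)
      (fun t => B (T + t) ω) (fun t => D (T + t) ω) s L) ≤ invGap s * ENNReal.ofReal (f ω) := by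
    filter_upwards [ae_eq_zero_or_eq_one h.measurable_B h.law_B,
      ae_eq_zero_or_eq_one h.measurable_D h.law_D] with ω hB hD
    have hD' : ∀ t, 0 ≤ D (T + t) ω := fun t => by rcases hD (T + t) with h | h <;> simp [h]
    have hgap := pow_mul_maxGap_le_maxGap_state (fun t => G (T + t)) hα hβ hκ.le hκ₁
      (E := fun t => E (T + t) ω) s (fun t => hB (T + t)) hD' L
    by_cases hA : ω ∈ A
    · refine invGap_le_of_mul_le two_pos (he _ _ _ hA.1 hA.2) ?_
      have h2 : 0 ≤ S.indicator (1 : Ω → ℝ) ω := Set.indicator_nonneg (by simp) ω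
      have h3 := mul_nonneg hκL.le h2
      simp only [f, Set.indicator_of_mem hA, Pi.one_apply]
      linarith
    · by_cases hS : ω ∈ S
      · refine invGap_le_of_mul_le (pow_pos hκ L) (le_trans ?_ hgap) ?_
        · refine mul_le_mul_of_nonneg_right (pow_le_pow_of_le_one hκ.le hκ₂ ?_) (maxGap_nonneg s)
          exact (Finset.card_filter_le _ _).trans (Finset.card_range L).le
        · simp [f, Set.indicator_of_mem hS, Set.indicator_of_notMem hA]
      · refine invGap_le_of_mul_le one_pos (le_of_eq_of_le ?_ hgap) ?_
        · have : (Finset.range L).filter (fun t => B (T + t) ω = 1) = ∅ :=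
            Finset.filter_eq_empty_iff.2 fun t ht ht' => hS ⟨t, Finset.mem_range.1 ht, ht'⟩
          rw [this, Finset.card_empty, pow_zero]
        · simp [f, Set.indicator_of_notMem hS, Set.indicator_of_notMem hA]
  refine (lintegral_mono_ae key).trans ?_
  rw [lintegral_const_mul _ (by
    exact ((measurable_const.sub ((measurable_one.indicator mA).div_const 2)).add
      ((measurable_one.indicator mS).const_mul _)).ennreal_ofReal),
    ← ofReal_integral_eq_lintegral_ofReal hfi (ae_of_all _ hf₀), mul_comm]
  refine mul_le_mul_left (ENNReal.ofReal_le_ofReal ?_) _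
  have h1 : (c * d) ^ L ≤ P.real A := h.pow_le_real_pattern hc T L fun t _ => hμ e t
  have h2 := mul_le_mul_of_nonneg_left (h.real_exists_eq_one_le T L) hκL.le
  refine hf.trans_le ?_
  linarith

end IsNetworkProcess

end RandomStates

/-! ### From contraction to almost sure divergence. -/

section Divergence

variable {V : Type*} [Fintype V] [DecidableEq V]

theorem measurable_state_process {Ω : Type*} [MeasurableSpace Ω] (G : ℕ → SignedDigraph V)
    (α β : ℝ) {E : ℕ → Ω → Finset (V × V)} {B D : ℕ → Ω → ℝ} (hE : ∀ t, Measurable (E t))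
    (hB : ∀ t, Measurable (B t)) (hD : ∀ t, Measurable (D t)) (s : V → ℝ) (T : ℕ) :
    Measurable fun ω => state G α β (fun t => E t ω) (fun t => B t ω) (fun t => D t ω) s T :=
  measurable_state G α β (measurable_pi_iff.2 hE) (measurable_pi_iff.2 hB)
    (measurable_pi_iff.2 hD) measurable_const T

variable {Ω : Type*} [MeasurableSpace Ω] {P : Measure Ω} [IsProbabilityMeasure P]
  {μ : ℕ → Measure (Finset (V × V))} {b d : unitInterval} {E : ℕ → Ω → Finset (V × V)}
  {B D : ℕ → Ω → ℝ}

/-- If the expected reciprocal gap contracts over the window after `T` from every fixed state,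
then it contracts along the process. -/
theorem IsNetworkProcess.lintegral_invGap_add_le
    (h : IsNetworkProcess P μ (fun _ => b) (fun _ => d) E B D) {G : ℕ → SignedDigraph V} {α β : ℝ}
    {ρ : ENNReal} {T L : ℕ}
    (hwin : ∀ s, ∫⁻ ω, invGap (state (fun t => G (T + t)) α β (fun t => E (T + t) ω)
      (fun t => B (T + t) ω) (fun t => D (T + t) ω) s L) ∂P ≤ ρ * invGap s) (s₀ : V → ℝ) :
    ∫⁻ ω, invGap (state G α β (fun t => E t ω) (fun t => B t ω) (fun t => D t ω) s₀ (T + L)) ∂P ≤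
      ρ * ∫⁻ ω, invGap (state G α β (fun t => E t ω) (fun t => B t ω) (fun t => D t ω) s₀ T) ∂P := by
  -- The state at `T` is frozen while the independent window is integrated out: a Markov property at
  -- time `T`.
  let F : (V → ℝ) → (ℕ → Finset (V × V)) × (ℕ → ℝ) × (ℕ → ℝ) → ENNReal := fun s z =>
    invGap (state (fun t => G (T + t)) α β z.1 z.2.1 z.2.2 s L)
  have mF : Measurable (Function.uncurry F) :=
    measurable_invGap.comp (measurable_state (fun t => G (T + t)) α β
      (measurable_fst.comp measurable_snd)
      (measurable_fst.comp (measurable_snd.comp measurable_snd))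
      (measurable_snd.comp (measurable_snd.comp measurable_snd)) measurable_fst L)
  have hF : ∀ s ω, F s (truncate L fun t => E (T + t) ω, truncate L fun t => B (T + t) ω,
      truncate L fun t => D (T + t) ω) = invGap (state (fun t => G (T + t)) α β
        (fun t => E (T + t) ω) (fun t => B (T + t) ω) (fun t => D (T + t) ω) s L) := fun s ω =>
    congrArg invGap (state_congr _ α β s (fun t ht => truncate_of_lt ht fun t => E (T + t) ω)
      (fun t ht => truncate_of_lt ht fun t => B (T + t) ω)
      (fun t ht => truncate_of_lt ht fun t => D (T + t) ω))
  have mS := measurable_state_process G α β h.measurable_E h.measurable_B h.measurable_D s₀ T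
  have mZ : Measurable fun ω => (truncate L fun t => E (T + t) ω, truncate L fun t => B (T + t) ω,
      truncate L fun t => D (T + t) ω) :=
    ((measurable_truncate_shift T L).comp (measurable_pi_iff.2 h.measurable_E)).prodMk
      (((measurable_truncate_shift T L).comp (measurable_pi_iff.2 h.measurable_B)).prodMk
        ((measurable_truncate_shift T L).comp (measurable_pi_iff.2 h.measurable_D)))
  have hFub := lintegral_of_indepFun mS mZ (h.indepFun_state_window G α β s₀ T L) mF
  simp only [hF] at hFub
  simp only [state_add]
  exact (hFub.trans_le (lintegral_mono fun ω => hwin _)).trans_eq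
    (lintegral_const_mul _ (measurable_invGap.comp mS))

/-- Geometric decay of the expected reciprocal gap forces the gap to diverge. -/
theorem IsNetworkProcess.ae_tendsto_maxGap
    (h : IsNetworkProcess P μ (fun _ => b) (fun _ => d) E B D) {G : ℕ → SignedDigraph V}
    {α β κ : ℝ} (hα : 0 ≤ α) (hβ : 0 ≤ β) (hκ : 0 < κ)
    (hκ₁ : κ ≤ 1 - 2 * α * (Fintype.card V - 1)) (hκ₂ : κ ≤ 1) {ρ : ENNReal} (hρ : ρ < 1) {L : ℕ}
    (hL : 0 < L) {s₀ : V → ℝ} (hs₀ : 0 < maxGap s₀)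
    (hstep : ∀ T, ∫⁻ ω, invGap (state G α β (fun t => E t ω) (fun t => B t ω) (fun t => D t ω)
        s₀ (T + L)) ∂P ≤
      ρ * ∫⁻ ω, invGap (state G α β (fun t => E t ω) (fun t => B t ω) (fun t => D t ω) s₀ T) ∂P) :
    ∀ᵐ ω ∂P, Tendsto (fun t => maxGap
      (state G α β (fun t => E t ω) (fun t => B t ω) (fun t => D t ω) s₀ t)) atTop atTop := by
  let X : ℕ → Ω → V → ℝ := fun t ω =>
    state G α β (fun t => E t ω) (fun t => B t ω) (fun t => D t ω) s₀ t
  have mX : ∀ t, Measurable fun ω => invGap (X t ω) := fun t => measurable_invGap.comp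
    (measurable_state_process G α β h.measurable_E h.measurable_B h.measurable_D s₀ t)
  have hgeom : ∀ k, ∫⁻ ω, invGap (X (k * L) ω) ∂P ≤ ρ ^ k * invGap s₀ := by
    intro k
    induction k with
    | zero => simp [X, state]
    | succ k ih =>
      rw [Nat.succ_mul, pow_succ', mul_assoc]
      exact (hstep (k * L)).trans (by gcongr)
  -- Tonelli and the geometric series; finiteness uses that the initial reciprocal gap is finite.
  have hsum : ∫⁻ ω, ∑' k, invGap (X (k * L) ω) ∂P ≠ ⊤ := by
    rw [lintegral_tsum fun k => (mX _).aemeasurable]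
    refine ne_top_of_le_ne_top ?_ (ENNReal.tsum_le_tsum hgeom)
    rw [ENNReal.tsum_mul_right, ENNReal.tsum_geometric]
    refine ENNReal.mul_ne_top (ENNReal.inv_ne_top.2 (tsub_pos_of_lt hρ).ne') ?_
    exact ENNReal.inv_ne_top.2 (by simpa using hs₀)
  filter_upwards [ae_lt_top (Measurable.tsum fun k => mX (k * L)) hsum,
    ae_eq_zero_or_eq_one h.measurable_B h.law_B,
    ae_eq_zero_or_eq_one h.measurable_D h.law_D] with ω hω hB hD
  have hD' : ∀ t, 0 ≤ D t ω := fun t => by rcases hD t with h | h <;> simp [h]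
  have h0 : Tendsto (fun k => invGap (X (k * L) ω)) atTop (nhds 0) :=
    ENNReal.tendsto_atTop_zero_of_tsum_ne_top hω.ne
  have hwin : ∀ k r, r ≤ L → κ ^ L * maxGap (X (k * L) ω) ≤ maxGap (X (k * L + r) ω) := by
    intro k r hr
    have h1 := pow_mul_maxGap_le_maxGap_state (fun t => G (k * L + t)) hα hβ hκ.le hκ₁
      (E := fun t => E (k * L + t) ω) (X (k * L) ω) (fun t => hB (k * L + t))
      (fun t => hD' (k * L + t)) r
    simp only [X] at h1 ⊢
    rw [state_add]
    refine le_trans (mul_le_mul_of_nonneg_right (pow_le_pow_of_le_one hκ.le hκ₂ ?_)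
      (maxGap_nonneg _)) h1
    exact (Finset.card_filter_le _ _).trans ((Finset.card_range r).le.trans hr)
  have hmain : Tendsto (fun k => maxGap (X (k * L) ω)) atTop atTop := by
    refine tendsto_atTop.2 fun M => ?_
    have hM : (0 : ENNReal) < (ENNReal.ofReal (max M 1))⁻¹ :=
      ENNReal.inv_pos.2 ENNReal.ofReal_ne_top
    filter_upwards [h0.eventually_lt_const hM] with k hk
    have := (ENNReal.ofReal_lt_ofReal_iff_of_nonneg (by positivity)).1 (ENNReal.inv_lt_inv.1 hk)
    exact (le_max_left _ _).trans this.le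
  -- Each `t` is compared with the last multiple of `L` before it, from which the gap has kept at
  -- least the fraction κ^L.
  refine tendsto_atTop_mono (fun t => ?_)
    ((hmain.comp (Nat.tendsto_div_const_atTop hL.ne')).const_mul_atTop (pow_pos hκ L))
  have := hwin (t / L) (t % L) (Nat.mod_lt t hL).le
  rwa [Nat.div_add_mod'] at this

/-- A vanishing gap forces the state into the hyperplane where coordinates i and j agree, which is
Lebesgue null. -/
theorem ae_maxGap_pos {i j : V} (hij : i ≠ j) : ∀ᵐ s : V → ℝ ∂volume, 0 < maxGap s := by
  let W : Submodule ℝ (V → ℝ) := LinearMap.ker (LinearMap.proj (R := ℝ) (φ := fun _ : V => ℝ) i -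
    LinearMap.proj j)
  have hW : W ≠ ⊤ := by
    intro h
    have : Pi.single i (1 : ℝ) ∈ W := h ▸ Submodule.mem_top
    simp [W, hij] at this
  have h0 := Measure.addHaar_submodule volume W hW
  filter_upwards [measure_eq_zero_iff_ae_notMem.1 h0] with s hs
  refine lt_of_lt_of_le (abs_pos.2 fun h => hs ?_) (abs_sub_le_maxGap s i j)
  simpa [W] using h

end Divergence

end SignedNetwork

/-! ### Choice of constants and conclusion. -/

open SignedNetwork in
theorem mainTheorem7 (n : ℕ) (hn : 3 ≤ n)
    (G : ℕ → SignedNetwork.SignedDigraph (Fin n))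
    (μ : ℕ → Measure (Finset (Fin n × Fin n))) [hprob : ∀ t, IsProbabilityMeasure (μ t)]
    (hμ : SignedNetwork.SupportedOn G μ)
    (hA1 : SignedNetwork.ArcProbabilityBoundedBelow G μ)
    (hA6 : SignedNetwork.ArcsIndependentBoundedAbove G μ)
    (hA8 : SignedNetwork.NegativeWindowsConnected G)
    (α β : ℝ) (hα₀ : 0 ≤ α) (hα₁ : α < (2 * ((n : ℝ) - 1))⁻¹) (hβ : 0 < β)
    (d : unitInterval) (hd₀ : 0 < d) (hd₁ : d < 1) :
    ∃ bstar : ℝ, 0 < bstar ∧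
      ∀ b : unitInterval, 0 < b → b < 1 → (b : ℝ) < bstar →
      ∀ (Ω : Type u) [MeasurableSpace Ω] (P : Measure Ω) [IsProbabilityMeasure P]
        (E : ℕ → Ω → Finset (Fin n × Fin n)) (B D : ℕ → Ω → ℝ),
        SignedNetwork.IsNetworkProcess P μ (fun _ => b) (fun _ => d) E B D →
        ∀ᵐ s₀ : Fin n → ℝ ∂volume, ∀ᵐ ω ∂P,
          Tendsto (fun t : ℕ => SignedNetwork.maxGap
            (SignedNetwork.state G α β (fun t => E t ω) (fun t => B t ω) (fun t => D t ω) s₀ t))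
            atTop atTop := by
  obtain ⟨c, hc₀, hc₁, hc⟩ := exists_forall_le_real_singleton hμ hA1 hA6
  obtain ⟨K, hK₁, hK⟩ := hA8
  have hn' : (3 : ℝ) ≤ n := by exact_mod_cast hn
  obtain ⟨m, hm⟩ := pow_unbounded_of_one_lt (2 * (Fintype.card (Fin n) : ℝ))
    (show 1 < 1 + β by linarith)
  have hm₁ : 1 ≤ m := by
    refine Nat.one_le_iff_ne_zero.2 fun h => ?_
    rw [h, Fintype.card_fin, pow_zero] at hm
    linarith
  let L := Fintype.card (Fin n × Fin n) * m * K
  have hL : 0 < L := by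
    have : 0 < Fintype.card (Fin n × Fin n) :=
      Fintype.card_pos_iff.2 ⟨(⟨0, by omega⟩, ⟨0, by omega⟩)⟩
    positivity
  let κ : ℝ := 1 - 2 * α * (Fintype.card (Fin n) - 1)
  -- This is where the upper bound on α enters: one step of positive interaction cannot close the
  -- gap.
  have hκ₀ : 0 < κ := by
    have h1 : 0 < 2 * ((n : ℝ) - 1) := by linarith
    have h2 := mul_lt_mul_of_pos_right hα₁ h1
    rw [inv_mul_cancel₀ h1.ne'] at h2
    simp only [κ, Fintype.card_fin]
    linarith
  have hκ₂ : κ ≤ 1 := by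
    have := mul_nonneg hα₀ (show (0 : ℝ) ≤ n - 1 by linarith)
    simp only [κ, Fintype.card_fin]
    linarith
  have hd₀' : (0 : ℝ) < d := hd₀
  have hcd₀ : 0 < (c * d) ^ L := pow_pos (mul_pos hc₀ hd₀') L
  have hcd₁ : (c * d) ^ L ≤ 1 :=
    pow_le_one₀ (mul_pos hc₀ hd₀').le (mul_le_one₀ hc₁ hd₀'.le d.2.2)
  have hκL : 0 < (κ ^ L)⁻¹ * L := mul_pos (inv_pos.2 (pow_pos hκ₀ L)) (by exact_mod_cast hL)
  -- The value of b at which the expected loss κ^(-L)Lb balances the expected gain (cd)^L/2.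
  refine ⟨(c * d) ^ L / 2 / ((κ ^ L)⁻¹ * L), by positivity, ?_⟩
  intro b hb₀ _ hb Ω _ P _ E B D h
  have hb₀' : (0 : ℝ) < b := hb₀
  rw [lt_div_iff₀' hκL, mul_assoc] at hb
  have hbpos : 0 < (κ ^ L)⁻¹ * (L * (b : ℝ)) := by
    rw [← mul_assoc]
    exact mul_pos hκL hb₀'
  have hne : (⟨0, by omega⟩ : Fin n) ≠ ⟨1, by omega⟩ := by simp
  filter_upwards [ae_maxGap_pos hne] with s₀ hs₀
  refine h.ae_tendsto_maxGap hα₀ hβ.le hκ₀ le_rfl hκ₂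
    (ρ := ENNReal.ofReal (1 - (c * d) ^ L / 2 + (κ ^ L)⁻¹ * (L * b))) ?_ hL hs₀
    fun T => h.lintegral_invGap_add_le (fun s => ?_) s₀
  · rw [← ENNReal.ofReal_one]
    exact (ENNReal.ofReal_lt_ofReal_iff one_pos).2 (by linarith)
  -- At consensus the bound reads ∞ ≤ ρ·∞, so ρ must be nonzero; this follows from (cd)^L ≤ 1.
  · rcases (maxGap_nonneg s).eq_or_lt with hs | hs
    · have : invGap s = ⊤ := by simp [invGap, ← hs]
      rw [this, ENNReal.mul_top]
      · exact le_top
      · exact (ENNReal.ofReal_pos.2 (by linarith)).ne'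
    · refine h.lintegral_invGap_window_le hα₀ hβ.le hκ₀ le_rfl hκ₂ hc₀.le
        (fun e t => hc (T + t) _ (soloArc_subset (fun t => G (T + t)) e t)) ?_
      refine exists_soloArc_two_mul_maxGap_le (fun t => ?_) hβ.le hm.le hm₁ s hs
      refine (hK (T + t)).mono ?_
      rintro e ⟨τ, hτ₁, hτ₂, hτ₃⟩
      refine ⟨τ - T, by omega, by omega, ?_⟩
      rwa [Nat.add_sub_cancel' (by omega)]
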